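/- Let $J:\mathbb{R}\to[0,\infty)$ be a $C^2$ function with derivative $j=J'$ such that (H1) $J(0)=0$ and $J(t)>0$ for all $t\in(0,\infty)$; (H2) $\displaystyle\liminf_{t\to-\infty}\frac{J(t)}{\sqrt{|t|}}>K$ for some $K>0$ (the value $+\infty$ of the lower limit being allowed); (H3$^-$) $j(t)<0$ for all $t\in(-\infty,0)$. Let $u:\mathbb{R}^2\to\mathbb{R}^2$ be a classical solution of $$-\Delta u=u\,j(1-|u|^2)\quad\text{in }\mathbb{R}^2,$$ that is, $u\in C^2(\mathbb{R}^2;\mathbb{R}^2)$ and the equation holds at every point. If $$\int_{\mathbb{R}^2}|\nabla u|^2\,dx<\infty\qquad\text{or}\qquad\int_{\mathbb{R}^2}J(1-|u|^2)\,dx<\infty,$$ then $|u(x)|\le 1$ for all $x\in\mathbb{R}^2$. -/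

import Mathlib

open scoped Real Topology ENNReal

/-- The Euclidean plane. -/
abbrev Plane : Type := EuclideanSpace ℝ (Fin 2)

/-- The squared Euclidean (Frobenius) norm `|∇u|² = ∑ᵢ |∂ᵢu|² = ∑ᵢⱼ (∂ᵢuⱼ)²` of the gradient. -/
noncomputable def gradSq (u : Plane → Plane) (x : Plane) : ℝ :=
  ∑ i : Fin 2, ‖fderiv ℝ u x (EuclideanSpace.single i 1)‖ ^ 2

/-- `u` is a classical solution of `-Δu = u j(1 - |u|²)` on the plane, where `j = J'`:
it is twice continuously differentiable and satisfies the equation at every point. -/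
def IsClassicalSolution (J : ℝ → ℝ) (u : Plane → Plane) : Prop :=
  ContDiff ℝ 2 u ∧ ∀ x : Plane, -(Laplacian.laplacian u x) = deriv J (1 - ‖u x‖ ^ 2) • u x

/-!
Fix `r > 1` and let `v` be a `C²` convex substitute for the excess `max (‖u‖ - r) 0`. Convexity
bounds `Δ v` from below by a nonnegative multiple of `⟪u, Δ u⟫`, and
`⟪u, Δ u⟫ = -j (1 - ‖u‖²) ‖u‖² > 0` where `‖u‖ > 1`; hence `v` is subharmonic, and `Δ v > 0`
wherever `‖u‖ > r`.

It remains to see that `Δ v = 0`, by testing `Δ v ≥ 0` against the dilates `φ (x / n)` of a smooth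
cutoff. If `∇ u` is square integrable, so is `∇ v`, and after one integration by parts the
Cauchy–Schwarz inequality bounds the result by the energy of the cutoff, which in dimension two is
independent of `n`, times a tail of the energy of `v`. If `J (1 - ‖u‖²)` is integrable, then so is
`v`, because `J (1 - ‖u‖²)` dominates `‖u‖` on `{‖u‖ ≥ r}`: this follows from the growth of `J` at
`-∞` and its monotonicity on `(-∞, 0)`. After two integrations by parts one gets a bound
`O(n⁻²) ∫ v`.
-/

open MeasureTheory Filter Set Module
open scoped Laplacian

section Laplacian

variable {E F : Type*} [NormedAddCommGroup E] [NormedAddCommGroup F] [NormedSpace ℝ F]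

section

variable [NormedSpace ℝ E]

theorem contDiff_fderiv_apply_of_contDiff_two {f : E → F} (hf : ContDiff ℝ 2 f) (e : E) :
    ContDiff ℝ 1 fun x => fderiv ℝ f x e :=
  (hf.fderiv_right (by norm_num)).clm_apply contDiff_const

theorem continuous_fderiv_apply_of_contDiff_one {f : E → F} (hf : ContDiff ℝ 1 f) (e : E) :
    Continuous fun x => fderiv ℝ f x e :=
  (hf.continuous_fderiv one_ne_zero).clm_apply continuous_const

theorem fderiv_fderiv_apply_self_nonneg_of_convexOn {G : F → ℝ} (hG : ContDiff ℝ 2 G)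
    (hconv : ConvexOn ℝ univ G) (y h : F) : 0 ≤ fderiv ℝ (fderiv ℝ G) y h h := by
  set line : ℝ →ᵃ[ℝ] F := AffineMap.lineMap y (y + h)
  have hline : ∀ t, HasDerivAt line h t := fun t => by
    simpa [line] using AffineMap.hasDerivAt_lineMap (a := y) (b := y + h) (x := t)
  have hderiv : ∀ t, HasDerivAt (G ∘ line) (fderiv ℝ G (line t) h) t := fun t =>
    (hG.differentiable two_ne_zero _).hasFDerivAt.comp_hasDerivAt t (hline t)
  have hmono : Monotone (deriv (G ∘ line)) := monotoneOn_univ.1 <|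
    (hconv.comp_affineMap line).monotoneOn_deriv fun t _ => (hderiv t).differentiableAt
  have hderiv₂ : HasDerivAt (deriv (G ∘ line)) (fderiv ℝ (fderiv ℝ G) y h h) 0 := by
    have hG' : HasFDerivAt (fderiv ℝ G) (fderiv ℝ (fderiv ℝ G) (line 0)) (line 0) :=
      ((hG.fderiv_right (m := 1) (by norm_num)).differentiable one_ne_zero _).hasFDerivAt
    have hD := (hG'.comp_hasDerivAt 0 (hline 0)).clm_apply (hasDerivAt_const 0 h)
    rw [funext fun t => (hderiv t).deriv]
    simpa [line] using hD
  exact hderiv₂.deriv ▸ hmono.deriv_nonneg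

end

variable [InnerProductSpace ℝ E] [FiniteDimensional ℝ E]

theorem laplacian_eq_sum_fderiv_fderiv {ι : Type*} [Fintype ι] (b : OrthonormalBasis ι ℝ E)
    {f : E → F} (hf : ContDiff ℝ 2 f) (x : E) :
    Δ f x = ∑ i, fderiv ℝ (fun y => fderiv ℝ f y (b i)) x (b i) := by
  have hf' : DifferentiableAt ℝ (fderiv ℝ f) x :=
    (hf.fderiv_right (m := 1) (by norm_num)).differentiable one_ne_zero x
  simp [InnerProductSpace.laplacian_eq_iteratedFDeriv_orthonormalBasis f b,
    iteratedFDeriv_two_apply, fderiv_clm_apply hf' (differentiableAt_const _)]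

theorem continuous_laplacian {f : E → F} (hf : ContDiff ℝ 2 f) : Continuous (Δ f) := by
  rw [funext (laplacian_eq_sum_fderiv_fderiv (stdOrthonormalBasis ℝ E) hf)]
  exact continuous_finsetSum _ fun i _ => continuous_fderiv_apply_of_contDiff_one
    (contDiff_fderiv_apply_of_contDiff_two hf _) _

theorem hasCompactSupport_laplacian {f : E → F} (hf : HasCompactSupport f) :
    HasCompactSupport (Δ f) := by
  refine (hf.iteratedFDeriv (𝕜 := ℝ) 2).mono fun x hx h0 => hx ?_
  simp [InnerProductSpace.laplacian_eq_iteratedFDeriv_stdOrthonormalBasis, h0]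

theorem laplacian_comp_const_smul {f : E → F} (hf : ContDiff ℝ 2 f) (c : ℝ) :
    Δ (fun x => f (c • x)) = fun x => c ^ 2 • Δ f (c • x) := by
  simp [InnerProductSpace.laplacian_eq_iteratedFDeriv_stdOrthonormalBasis,
    iteratedFDeriv_comp_const_smul c (i := 2) hf, Finset.smul_sum]

theorem laplacian_comp {H ι : Type*} [NormedAddCommGroup H] [NormedSpace ℝ H] [Fintype ι]
    (b : OrthonormalBasis ι ℝ E) {G : F → H} {u : E → F} (hG : ContDiff ℝ 2 G)
    (hu : ContDiff ℝ 2 u) (x : E) :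
    Δ (G ∘ u) x = ∑ i, fderiv ℝ (fderiv ℝ G) (u x) (fderiv ℝ u x (b i)) (fderiv ℝ u x (b i)) +
      fderiv ℝ G (u x) (Δ u x) := by
  have hud : Differentiable ℝ u := hu.differentiable two_ne_zero
  have hGd : Differentiable ℝ G := hG.differentiable two_ne_zero
  have hG' : DifferentiableAt ℝ (fderiv ℝ G) (u x) :=
    (hG.fderiv_right (m := 1) (by norm_num)).differentiable one_ne_zero _
  have hchain : ∀ i, (fun y => fderiv ℝ (G ∘ u) y (b i)) =
      fun y => fderiv ℝ G (u y) (fderiv ℝ u y (b i)) := fun i => by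
    ext y
    rw [fderiv_comp y (hGd _) (hud y), ContinuousLinearMap.comp_apply]
  rw [laplacian_eq_sum_fderiv_fderiv b (hG.comp hu), laplacian_eq_sum_fderiv_fderiv b hu, map_sum,
    ← Finset.sum_add_distrib]
  refine Finset.sum_congr rfl fun i _ => ?_
  have hD := (hG'.hasFDerivAt.comp x (hud x).hasFDerivAt).clm_apply
    ((contDiff_fderiv_apply_of_contDiff_two hu (b i)).differentiable one_ne_zero x).hasFDerivAt
  rw [hchain]
  exact (DFunLike.congr_fun hD.fderiv (b i)).trans (by simp [add_comm])

theorem fderiv_laplacian_le_laplacian_comp_of_convexOn {G : F → ℝ} {u : E → F}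
    (hG : ContDiff ℝ 2 G) (hconv : ConvexOn ℝ univ G) (hu : ContDiff ℝ 2 u) (x : E) :
    fderiv ℝ G (u x) (Δ u x) ≤ Δ (G ∘ u) x := by
  rw [laplacian_comp (stdOrthonormalBasis ℝ E) hG hu]
  exact le_add_of_nonneg_left <| Finset.sum_nonneg fun i _ =>
    fderiv_fderiv_apply_self_nonneg_of_convexOn hG hconv _ _

end Laplacian

section Green

variable {E : Type*} [NormedAddCommGroup E] [InnerProductSpace ℝ E] [FiniteDimensional ℝ E]
  [MeasurableSpace E] [BorelSpace E] (μ : Measure E) [μ.IsAddHaarMeasure] {f g : E → ℝ}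

theorem integral_mul_fderiv_of_hasCompactSupport (hf : ContDiff ℝ 1 f) (hg : ContDiff ℝ 1 g)
    (hc : HasCompactSupport f) (e : E) :
    ∫ x, f x * fderiv ℝ g x e ∂μ = -∫ x, fderiv ℝ f x e * g x ∂μ := by
  refine integral_mul_fderiv_eq_neg_fderiv_mul_of_integrable ?_ ?_ ?_
    (fun x _ => hf.differentiable one_ne_zero x) (fun x _ => hg.differentiable one_ne_zero x)
  · exact ((continuous_fderiv_apply_of_contDiff_one hf e).mul
      hg.continuous).integrable_of_hasCompactSupport (hc.fderiv_apply ℝ e).mul_right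
  · exact (hf.continuous.mul
      (continuous_fderiv_apply_of_contDiff_one hg e)).integrable_of_hasCompactSupport hc.mul_right
  · exact (hf.continuous.mul hg.continuous).integrable_of_hasCompactSupport hc.mul_right

variable {ι : Type*} [Fintype ι] (b : OrthonormalBasis ι ℝ E)

theorem integral_mul_laplacian (hf : ContDiff ℝ 1 f) (hg : ContDiff ℝ 2 g)
    (hc : HasCompactSupport f) :
    ∫ x, f x * Δ g x ∂μ = -∑ i, ∫ x, fderiv ℝ f x (b i) * fderiv ℝ g x (b i) ∂μ := by
  simp only [laplacian_eq_sum_fderiv_fderiv b hg, Finset.mul_sum]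
  rw [integral_finsetSum, ← Finset.sum_neg_distrib]
  · exact Finset.sum_congr rfl fun i _ => integral_mul_fderiv_of_hasCompactSupport μ hf
      (contDiff_fderiv_apply_of_contDiff_two hg _) hc _
  · exact fun i _ => (hf.continuous.mul (continuous_fderiv_apply_of_contDiff_one
      (contDiff_fderiv_apply_of_contDiff_two hg _) _)).integrable_of_hasCompactSupport hc.mul_right

theorem integral_laplacian_mul (hf : ContDiff ℝ 2 f) (hg : ContDiff ℝ 1 g)
    (hc : HasCompactSupport f) :
    ∫ x, Δ f x * g x ∂μ = -∑ i, ∫ x, fderiv ℝ f x (b i) * fderiv ℝ g x (b i) ∂μ := by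
  have hf' := fun i => contDiff_fderiv_apply_of_contDiff_two hf (b i)
  have hc' := fun i => hc.fderiv_apply ℝ (b i)
  simp only [laplacian_eq_sum_fderiv_fderiv b hf, Finset.sum_mul]
  rw [integral_finsetSum, ← Finset.sum_neg_distrib]
  · refine Finset.sum_congr rfl fun i _ => ?_
    rw [integral_mul_fderiv_of_hasCompactSupport μ (hf' i) hg (hc' i), neg_neg]
  · exact fun i _ => ((continuous_fderiv_apply_of_contDiff_one (hf' i) _).mul
      hg.continuous).integrable_of_hasCompactSupport ((hc' i).fderiv_apply ℝ _).mul_right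

theorem integral_mul_laplacian_comm (hf : ContDiff ℝ 2 f) (hg : ContDiff ℝ 2 g)
    (hc : HasCompactSupport f) : ∫ x, f x * Δ g x ∂μ = ∫ x, Δ f x * g x ∂μ := by
  rw [integral_mul_laplacian μ (stdOrthonormalBasis ℝ E) (hf.of_le one_le_two) hg hc,
    integral_laplacian_mul μ (stdOrthonormalBasis ℝ E) hf (hg.of_le one_le_two) hc]

end Green

section CauchySchwarz

variable {α : Type*} [MeasurableSpace α] {μ : Measure α} {F : Type*} [NormedAddCommGroup F]

theorem integral_norm_mul_norm_le_sqrt_mul_sqrt {f g : α → F} (hf : MemLp f 2 μ)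
    (hg : MemLp g 2 μ) :
    ∫ x, ‖f x‖ * ‖g x‖ ∂μ ≤ √(∫ x, ‖f x‖ ^ 2 ∂μ) * √(∫ x, ‖g x‖ ^ 2 ∂μ) := by
  have h := integral_mul_norm_le_Lp_mul_Lq (μ := μ) (f := f) (g := g) Real.HolderConjugate.two_two
    (by simpa using hf) (by simpa using hg)
  simpa [Real.sqrt_eq_rpow] using h

end CauchySchwarz

section Cutoff

variable (E : Type*) [NormedAddCommGroup E] [InnerProductSpace ℝ E]

/-- The standard smooth cutoff function equal to `1` on the ball of radius `n + 1` and supported in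
the ball of radius `2 * (n + 1)`. All of them are dilations of `cutoff E 0`. -/
noncomputable def cutoff (n : ℕ) : ContDiffBump (0 : E) where
  rIn := n + 1
  rOut := 2 * (n + 1)
  rIn_pos := by positivity
  rIn_lt_rOut := by linarith

variable {E}

theorem cutoff_eq_cutoff_zero_smul (n : ℕ) :
    ⇑(cutoff E n) = fun x => cutoff E 0 ((n + 1 : ℝ)⁻¹ • x) := by
  have hn : (n + 1 : ℝ) ≠ 0 := by positivity
  ext x
  simp [ContDiffBump.apply, cutoff, hn]

theorem cutoff_le_cutoff {m n : ℕ} (hmn : 2 * (m + 1) ≤ n + 1) (x : E) :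
    cutoff E m x ≤ cutoff E n x := by
  have hmn' : 2 * (m + 1) ≤ (n + 1 : ℝ) := by exact_mod_cast hmn
  rcases le_total ‖x‖ (n + 1) with hx | hx
  · rw [(cutoff E n).one_of_mem_closedBall (mem_closedBall_zero_iff.2 hx)]
    exact (cutoff E m).le_one
  · rw [(cutoff E m).zero_of_le_dist (by rw [dist_zero_right]; exact hmn'.trans hx)]
    exact (cutoff E n).nonneg

theorem fderiv_cutoff_eq_zero {n : ℕ} {x : E} (hx : ‖x‖ < n + 1) :
    fderiv ℝ (cutoff E n) x = 0 := by
  rw [((cutoff E n).eventuallyEq_one_of_mem_ball (mem_ball_zero_iff.2 hx)).fderiv_eq]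
  exact fderiv_const_apply 1

theorem fderiv_cutoff (n : ℕ) (x : E) :
    fderiv ℝ (cutoff E n) x = (n + 1 : ℝ)⁻¹ • fderiv ℝ (cutoff E 0) ((n + 1 : ℝ)⁻¹ • x) := by
  rw [cutoff_eq_cutoff_zero_smul]
  exact _root_.fderiv_comp_smul _

variable [FiniteDimensional ℝ E]

theorem laplacian_cutoff (n : ℕ) (x : E) :
    Δ ⇑(cutoff E n) x = ((n + 1 : ℝ)⁻¹) ^ 2 * Δ ⇑(cutoff E 0) ((n + 1 : ℝ)⁻¹ • x) := by
  rw [cutoff_eq_cutoff_zero_smul, laplacian_comp_const_smul (cutoff E 0).contDiff]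
  rfl

variable [MeasurableSpace E] [BorelSpace E] (μ : Measure E) [μ.IsAddHaarMeasure]

theorem memLp_fderiv_cutoff (n : ℕ) : MemLp (fderiv ℝ (cutoff E n)) 2 μ :=
  ((cutoff E n).contDiff.continuous_fderiv one_ne_zero).memLp_of_hasCompactSupport
    ((cutoff E n).hasCompactSupport.fderiv ℝ)

theorem integral_sq_norm_fderiv_cutoff_le (hdim : finrank ℝ E ≤ 2) (n : ℕ) :
    ∫ x, ‖fderiv ℝ (cutoff E n) x‖ ^ 2 ∂μ ≤ ∫ x, ‖fderiv ℝ (cutoff E 0) x‖ ^ 2 ∂μ := by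
  set R : ℝ := n + 1
  have hR : 1 ≤ R := by simp [R]
  have hR₀ : 0 ≤ R := zero_le_one.trans hR
  have hscale : (R⁻¹) ^ 2 * R ^ finrank ℝ E ≤ 1 := by
    rw [inv_pow, inv_mul_le_one₀ (by positivity)]
    exact pow_le_pow_right₀ hR hdim
  calc ∫ x, ‖fderiv ℝ (cutoff E n) x‖ ^ 2 ∂μ
      = ∫ x, (R⁻¹) ^ 2 * ‖fderiv ℝ (cutoff E 0) (R⁻¹ • x)‖ ^ 2 ∂μ := by
        simp only [fderiv_cutoff n, norm_smul, mul_pow, norm_inv, Real.norm_of_nonneg hR₀, R]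
    _ = (R⁻¹) ^ 2 * R ^ finrank ℝ E * ∫ x, ‖fderiv ℝ (cutoff E 0) x‖ ^ 2 ∂μ := by
        rw [integral_const_mul, Measure.integral_comp_inv_smul_of_nonneg μ
          (fun x => ‖fderiv ℝ (cutoff E 0) x‖ ^ 2) (by positivity), smul_eq_mul, mul_assoc]
    _ ≤ ∫ x, ‖fderiv ℝ (cutoff E 0) x‖ ^ 2 ∂μ :=
        mul_le_of_le_one_left (integral_nonneg fun x => by positivity) hscale

theorem eq_zero_of_tendsto_integral_cutoff_mul {w : E → ℝ} (hw : Continuous w) (h0 : ∀ x, 0 ≤ w x)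
    (hlim : Tendsto (fun n => ∫ x, cutoff E n x * w x ∂μ) atTop (𝓝 0)) (x : E) : w x = 0 := by
  by_contra hx
  have hcont : ∀ n, Continuous fun y => cutoff E n y * w y := fun n =>
    (cutoff E n).continuous.mul hw
  have hsupp : ∀ n, HasCompactSupport fun y => cutoff E n y * w y := fun n =>
    (cutoff E n).hasCompactSupport.mul_right
  obtain ⟨m, hm⟩ := exists_nat_ge ‖x‖
  have hpos : 0 < ∫ y, cutoff E m y * w y ∂μ := by
    refine (hcont m).integral_pos_of_hasCompactSupport_nonneg_nonzero (x := x) (hsupp m)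
      (fun y => mul_nonneg (cutoff E m).nonneg (h0 y)) ?_
    rwa [(cutoff E m).one_of_mem_closedBall
      (mem_closedBall_zero_iff.2 <| hm.trans (by simp [cutoff])), one_mul]
  refine hpos.not_ge (ge_of_tendsto hlim ?_)
  filter_upwards [eventually_ge_atTop (2 * (m + 1))] with n hn
  exact integral_mono ((hcont m).integrable_of_hasCompactSupport (hsupp m))
    ((hcont n).integrable_of_hasCompactSupport (hsupp n))
    fun y => mul_le_mul_of_nonneg_right (cutoff_le_cutoff (by lia) y) (h0 y)

end Cutoff

section Tail

variable {E G : Type*} [SeminormedAddCommGroup E] [MeasurableSpace E] [OpensMeasurableSpace E]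
  [NormedAddCommGroup G] [NormedSpace ℝ G] {μ : Measure E}

theorem tendsto_setIntegral_compl_ball_atTop {f : E → G} (hf : Integrable f μ) :
    Tendsto (fun n : ℕ => ∫ x in (Metric.ball 0 (n + 1))ᶜ, f x ∂μ) atTop (𝓝 0) := by
  have hanti : Antitone fun n : ℕ => (Metric.ball (0 : E) (n + 1))ᶜ := fun m n hmn =>
    compl_subset_compl.2 <| Metric.ball_subset_ball (by gcongr)
  have hempty : ⋂ n : ℕ, (Metric.ball (0 : E) (n + 1))ᶜ = ∅ := by
    rw [← compl_iUnion, compl_empty_iff, eq_univ_iff_forall]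
    intro x
    obtain ⟨n, hn⟩ := exists_nat_gt ‖x‖
    exact mem_iUnion.2 ⟨n, mem_ball_zero_iff.2 (hn.trans (lt_add_one _))⟩
  simpa [hempty] using tendsto_setIntegral_of_antitone
    (fun _ => Metric.isOpen_ball.measurableSet.compl) hanti ⟨0, hf.integrableOn⟩

end Tail

section Liouville

variable {E : Type*} [NormedAddCommGroup E] [InnerProductSpace ℝ E] [FiniteDimensional ℝ E]
  [MeasurableSpace E] [BorelSpace E] (μ : Measure E) [μ.IsAddHaarMeasure] {v : E → ℝ}

theorem laplacian_eq_zero_of_integrable (hv : ContDiff ℝ 2 v) (hsub : ∀ x, 0 ≤ Δ v x)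
    (hint : Integrable v μ) : ∀ x, Δ v x = 0 := by
  obtain ⟨C, hC⟩ := (hasCompactSupport_laplacian (cutoff E 0).hasCompactSupport
    ).exists_bound_of_continuous (continuous_laplacian (cutoff E 0).contDiff)
  refine eq_zero_of_tendsto_integral_cutoff_mul μ (continuous_laplacian hv) hsub ?_
  have hscale : Tendsto (fun n : ℕ => ((n + 1 : ℝ)⁻¹) ^ 2 * ∫ x, C * ‖v x‖ ∂μ) atTop (𝓝 0) := by
    simpa using (tendsto_one_div_add_atTop_nhds_zero_nat (𝕜 := ℝ).pow 2).mul_const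
      (∫ x, C * ‖v x‖ ∂μ)
  refine squeeze_zero_norm (fun n => ?_) hscale
  rw [integral_mul_laplacian_comm μ (cutoff E n).contDiff hv (cutoff E n).hasCompactSupport,
    ← integral_const_mul]
  refine norm_integral_le_of_norm_le ((hint.norm.const_mul C).const_mul _) (ae_of_all _ fun x => ?_)
  rw [laplacian_cutoff, norm_mul, norm_mul, Real.norm_of_nonneg (by positivity), mul_assoc]
  gcongr
  exact hC _

-- The energy of the cutoffs stays bounded because `finrank ℝ E ≤ 2`, while their derivatives only
-- see the tail of `fderiv ℝ v`.
theorem tendsto_integral_fderiv_cutoff_mul_fderiv (hdim : finrank ℝ E ≤ 2)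
    (hv : MemLp (fderiv ℝ v) 2 μ) (e : E) :
    Tendsto (fun n => ∫ x, fderiv ℝ (cutoff E n) x e * fderiv ℝ v x e ∂μ) atTop (𝓝 0) := by
  set tail : ℕ → Set E := fun n => (Metric.ball 0 (n + 1))ᶜ
  set A := ∫ x, ‖fderiv ℝ (cutoff E 0) x‖ ^ 2 ∂μ
  have hlim : Tendsto (fun n => ‖e‖ ^ 2 * (√A * √(∫ x in tail n, ‖fderiv ℝ v x‖ ^ 2 ∂μ)))
      atTop (𝓝 0) := by
    simpa using (((tendsto_setIntegral_compl_ball_atTop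
      (hv.integrable_norm_pow two_ne_zero)).sqrt).const_mul (√A)).const_mul (‖e‖ ^ 2)
  refine squeeze_zero_norm (fun n => ?_) hlim
  set φ := cutoff E n
  have hφ : MemLp (fderiv ℝ φ) 2 μ := memLp_fderiv_cutoff μ n
  have hprod : Integrable (fun x => ‖fderiv ℝ φ x‖ * ‖fderiv ℝ v x‖) μ :=
    hφ.norm.integrable_mul hv.norm
  calc ‖∫ x, fderiv ℝ φ x e * fderiv ℝ v x e ∂μ‖
      = ‖∫ x in tail n, fderiv ℝ φ x e * fderiv ℝ v x e ∂μ‖ := by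
        rw [setIntegral_eq_integral_of_forall_compl_eq_zero fun x hx => ?_]
        simp [φ, fderiv_cutoff_eq_zero (mem_ball_zero_iff.1 (notMem_compl_iff.1 hx))]
    _ ≤ ∫ x in tail n, ‖e‖ ^ 2 * (‖fderiv ℝ φ x‖ * ‖fderiv ℝ v x‖) ∂μ := by
        refine norm_integral_le_of_norm_le (hprod.integrableOn.const_mul _) <|
          ae_of_all _ fun x => ?_
        calc ‖fderiv ℝ φ x e * fderiv ℝ v x e‖
            ≤ (‖fderiv ℝ φ x‖ * ‖e‖) * (‖fderiv ℝ v x‖ * ‖e‖) :=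
              norm_mul_le_of_le (ContinuousLinearMap.le_opNorm _ _)
                (ContinuousLinearMap.le_opNorm _ _)
          _ = ‖e‖ ^ 2 * (‖fderiv ℝ φ x‖ * ‖fderiv ℝ v x‖) := by ring
    _ ≤ ‖e‖ ^ 2 * (√(∫ x in tail n, ‖fderiv ℝ φ x‖ ^ 2 ∂μ) *
          √(∫ x in tail n, ‖fderiv ℝ v x‖ ^ 2 ∂μ)) := by
        rw [integral_const_mul]
        gcongr
        exact integral_norm_mul_norm_le_sqrt_mul_sqrt (hφ.restrict _) (hv.restrict _)
    _ ≤ ‖e‖ ^ 2 * (√A * √(∫ x in tail n, ‖fderiv ℝ v x‖ ^ 2 ∂μ)) := by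
        gcongr
        exact (setIntegral_le_integral (hφ.integrable_norm_pow two_ne_zero)
          (ae_of_all _ fun x => by positivity)).trans (integral_sq_norm_fderiv_cutoff_le μ hdim n)

theorem laplacian_eq_zero_of_memLp_fderiv (hdim : finrank ℝ E ≤ 2) (hv : ContDiff ℝ 2 v)
    (hsub : ∀ x, 0 ≤ Δ v x) (henergy : MemLp (fderiv ℝ v) 2 μ) : ∀ x, Δ v x = 0 := by
  refine eq_zero_of_tendsto_integral_cutoff_mul μ (continuous_laplacian hv) hsub ?_
  simp only [integral_mul_laplacian μ (stdOrthonormalBasis ℝ E) (cutoff E _).contDiff hv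
    (cutoff E _).hasCompactSupport]
  simpa using (tendsto_finsetSum Finset.univ fun i _ =>
    tendsto_integral_fderiv_cutoff_mul_fderiv μ hdim henergy (stdOrthonormalBasis ℝ E i)).neg

end Liouville

section SmoothRamp

/-- A `C²` convex replacement for the positive part `t ↦ max t 0`: it vanishes on `(-∞, 0]`, and its
derivative is positive on `(0, ∞)` and at most `1`. -/
noncomputable def smoothRamp (t : ℝ) : ℝ := ∫ s in (0 : ℝ)..t, Real.smoothTransition s

theorem hasDerivAt_smoothRamp (t : ℝ) : HasDerivAt smoothRamp (Real.smoothTransition t) t :=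
  Real.smoothTransition.continuous.integral_hasStrictDerivAt 0 t |>.hasDerivAt

theorem deriv_smoothRamp : deriv smoothRamp = Real.smoothTransition :=
  funext fun t => (hasDerivAt_smoothRamp t).deriv

theorem differentiable_smoothRamp : Differentiable ℝ smoothRamp := fun t =>
  (hasDerivAt_smoothRamp t).differentiableAt

theorem contDiff_smoothRamp : ContDiff ℝ 2 smoothRamp := by
  rw [show (2 : WithTop ℕ∞) = 1 + 1 by norm_num, contDiff_succ_iff_deriv, deriv_smoothRamp]
  exact ⟨differentiable_smoothRamp, by simp, Real.smoothTransition.contDiff⟩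

theorem smoothRamp_of_nonpos {t : ℝ} (ht : t ≤ 0) : smoothRamp t = 0 := by
  rw [smoothRamp, intervalIntegral.integral_congr (g := fun _ => (0 : ℝ)),
    intervalIntegral.integral_zero]
  intro s hs
  rw [uIcc_of_ge ht] at hs
  exact Real.smoothTransition.zero_of_nonpos hs.2

theorem monotone_smoothRamp : Monotone smoothRamp :=
  monotone_of_deriv_nonneg differentiable_smoothRamp fun t => by
    rw [deriv_smoothRamp]
    exact Real.smoothTransition.nonneg t

theorem convexOn_smoothRamp : ConvexOn ℝ univ smoothRamp :=
  Monotone.convexOn_univ_of_deriv differentiable_smoothRamp <| by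
    rw [deriv_smoothRamp]
    exact Real.smoothTransition.monotone

theorem lipschitzWith_smoothRamp : LipschitzWith 1 smoothRamp :=
  lipschitzWith_of_nnnorm_deriv_le differentiable_smoothRamp fun t => by
    rw [deriv_smoothRamp, ← NNReal.coe_le_coe, coe_nnnorm,
      Real.norm_of_nonneg (Real.smoothTransition.nonneg t)]
    exact Real.smoothTransition.le_one t

theorem smoothRamp_nonneg (t : ℝ) : 0 ≤ smoothRamp t :=
  (smoothRamp_of_nonpos (min_le_right t 0)).ge.trans (monotone_smoothRamp (min_le_left t 0))

theorem smoothRamp_le {t : ℝ} (ht : 0 ≤ t) : smoothRamp t ≤ t := by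
  have h := lipschitzWith_smoothRamp.dist_le_mul t 0
  rw [smoothRamp_of_nonpos le_rfl, dist_zero_right, dist_zero_right, NNReal.coe_one, one_mul,
    Real.norm_of_nonneg ht] at h
  exact (le_abs_self _).trans h

end SmoothRamp

section SmoothExcess

variable {F : Type*} [NormedAddCommGroup F] {r : ℝ} {y : F}

/-- A `C²` convex replacement for the excess `max (‖y‖ - r) 0` of the norm of `y` over `r`. -/
noncomputable def smoothExcess (r : ℝ) (y : F) : ℝ := smoothRamp (‖y‖ - r)

theorem smoothExcess_nonneg (r : ℝ) (y : F) : 0 ≤ smoothExcess r y := smoothRamp_nonneg _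

theorem smoothExcess_of_norm_le (hy : ‖y‖ ≤ r) : smoothExcess r y = 0 :=
  smoothRamp_of_nonpos (sub_nonpos.2 hy)

theorem smoothExcess_le_norm (hr : 0 ≤ r) (hy : r ≤ ‖y‖) : smoothExcess r y ≤ ‖y‖ :=
  (smoothRamp_le (sub_nonneg.2 hy)).trans (sub_le_self _ hr)

theorem lipschitzWith_smoothExcess : LipschitzWith 1 (smoothExcess r : F → ℝ) := by
  have h := lipschitzWith_smoothRamp.comp
    ((lipschitzWith_one_norm (E := F)).sub (LipschitzWith.const r))
  rwa [add_zero, one_mul] at h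

theorem convexOn_smoothExcess [NormedSpace ℝ F] (r : ℝ) :
    ConvexOn ℝ univ (smoothExcess r : F → ℝ) := by
  have hrange : Convex ℝ ((fun y : F => ‖y‖ - r) '' univ) :=
    (isPreconnected_univ.image _ (by fun_prop)).ordConnected.convex
  exact (convexOn_smoothRamp.subset (subset_univ _) hrange).comp
    (convexOn_univ_norm.sub (concaveOn_const r convex_univ)) (monotone_smoothRamp.monotoneOn _)

variable [InnerProductSpace ℝ F]

theorem contDiff_smoothExcess (hr : 0 < r) : ContDiff ℝ 2 (smoothExcess r : F → ℝ) := by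
  refine contDiff_iff_contDiffAt.2 fun y => ?_
  rcases eq_or_ne y 0 with rfl | hy
  · refine contDiffAt_const (c := (0 : ℝ)).congr_of_eventuallyEq ?_
    filter_upwards [Metric.ball_mem_nhds 0 hr] with y hy
    exact smoothExcess_of_norm_le (mem_ball_zero_iff.1 hy).le
  · exact contDiff_smoothRamp.contDiffAt.comp y ((contDiffAt_norm ℝ hy).sub contDiffAt_const)

theorem hasFDerivAt_norm (hy : y ≠ 0) :
    HasFDerivAt (fun w : F => ‖w‖) (‖y‖⁻¹ • innerSL ℝ y) y := by
  have h := (hasStrictFDerivAt_norm_sq y).hasFDerivAt.sqrt (pow_ne_zero 2 (norm_ne_zero_iff.2 hy))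
  simp only [Real.sqrt_sq (norm_nonneg _), ← ofNat_smul_eq_nsmul ℝ, smul_smul] at h
  convert h using 2
  ring

theorem fderiv_smoothExcess (hr : 0 < r) (y z : F) :
    fderiv ℝ (smoothExcess r) y z =
      Real.smoothTransition (‖y‖ - r) / ‖y‖ * inner ℝ y z := by
  rcases le_or_gt ‖y‖ r with hy | hy
  · have hmin : IsLocalMin (smoothExcess r) y := Eventually.of_forall fun w =>
      (smoothExcess_of_norm_le hy).trans_le (smoothExcess_nonneg r w)
    simp [hmin.fderiv_eq_zero, Real.smoothTransition.zero_of_nonpos (sub_nonpos.2 hy)]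
  · have h : HasFDerivAt (smoothExcess r)
        (Real.smoothTransition (‖y‖ - r) • ‖y‖⁻¹ • innerSL ℝ y) y :=
      (hasDerivAt_smoothRamp _).comp_hasFDerivAt y
        ((hasFDerivAt_norm (norm_pos_iff.1 (hr.trans hy))).sub_const r)
    simp [h.fderiv, div_eq_mul_inv, mul_assoc]

end SmoothExcess

section LaplacianSmoothExcess

variable {E F : Type*} [NormedAddCommGroup E] [InnerProductSpace ℝ E] [FiniteDimensional ℝ E]
  [NormedAddCommGroup F] [InnerProductSpace ℝ F] {u : E → F} {M r : ℝ}

theorem smoothTransition_div_norm_mul_inner_laplacian_le (hu : ContDiff ℝ 2 u) (hr : 0 < r)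
    (x : E) :
    Real.smoothTransition (‖u x‖ - r) / ‖u x‖ * inner ℝ (u x) (Δ u x) ≤
      Δ (smoothExcess r ∘ u) x := by
  rw [← fderiv_smoothExcess hr]
  exact fderiv_laplacian_le_laplacian_comp_of_convexOn (contDiff_smoothExcess hr)
    (convexOn_smoothExcess r) hu x

variable (hu : ContDiff ℝ 2 u) (hM : 0 ≤ M)
  (hinner : ∀ x, M < ‖u x‖ → 0 < inner ℝ (u x) (Δ u x))
include hu hM hinner

theorem laplacian_smoothExcess_comp_pos (hr : M < r) {x : E} (hx : r < ‖u x‖) :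
    0 < Δ (smoothExcess r ∘ u) x := by
  have hr₀ : 0 < r := hM.trans_lt hr
  refine lt_of_lt_of_le ?_ (smoothTransition_div_norm_mul_inner_laplacian_le hu hr₀ x)
  exact mul_pos (div_pos (Real.smoothTransition.pos_of_pos (sub_pos.2 hx)) (hr₀.trans hx))
    (hinner x (hr.trans hx))

theorem laplacian_smoothExcess_comp_nonneg (hr : M < r) (x : E) :
    0 ≤ Δ (smoothExcess r ∘ u) x := by
  rcases le_or_gt ‖u x‖ r with hx | hx
  · refine le_trans (le_of_eq ?_)
      (smoothTransition_div_norm_mul_inner_laplacian_le hu (hM.trans_lt hr) x)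
    rw [Real.smoothTransition.zero_of_nonpos (sub_nonpos.2 hx), zero_div, zero_mul]
  · exact (laplacian_smoothExcess_comp_pos hu hM hinner hr hx).le

theorem norm_le_of_laplacian_smoothExcess_comp_eq_zero
    (hzero : ∀ r, M < r → ∀ x, Δ (smoothExcess r ∘ u) x = 0) (x : E) : ‖u x‖ ≤ M := by
  by_contra! hx
  obtain ⟨r, hMr, hrx⟩ := exists_between hx
  exact (laplacian_smoothExcess_comp_pos hu hM hinner hMr hrx).ne' (hzero r hMr x)

variable [MeasurableSpace E] [BorelSpace E] (μ : Measure E) [μ.IsAddHaarMeasure]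

theorem norm_le_of_integrable_smoothExcess_comp
    (hint : ∀ r, M < r → Integrable (smoothExcess r ∘ u) μ) (x : E) : ‖u x‖ ≤ M :=
  norm_le_of_laplacian_smoothExcess_comp_eq_zero hu hM hinner (fun r hr =>
    laplacian_eq_zero_of_integrable μ ((contDiff_smoothExcess (hM.trans_lt hr)).comp hu)
      (laplacian_smoothExcess_comp_nonneg hu hM hinner hr) (hint r hr)) x

theorem norm_le_of_memLp_fderiv (hdim : finrank ℝ E ≤ 2) (henergy : MemLp (fderiv ℝ u) 2 μ)
    (x : E) : ‖u x‖ ≤ M := by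
  refine norm_le_of_laplacian_smoothExcess_comp_eq_zero hu hM hinner (fun r hr => ?_) x
  have hexcess := contDiff_smoothExcess (F := F) (hM.trans_lt hr)
  refine laplacian_eq_zero_of_memLp_fderiv μ hdim (hexcess.comp hu)
    (laplacian_smoothExcess_comp_nonneg hu hM hinner hr) (henergy.of_le
      ((hexcess.comp hu).continuous_fderiv two_ne_zero).aestronglyMeasurable
      (ae_of_all _ fun x => ?_))
  rw [fderiv_comp x (hexcess.differentiable two_ne_zero _) (hu.differentiable two_ne_zero x)]
  calc ‖(fderiv ℝ (smoothExcess r) (u x)).comp (fderiv ℝ u x)‖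
      ≤ ‖fderiv ℝ (smoothExcess r) (u x)‖ * ‖fderiv ℝ u x‖ :=
        ContinuousLinearMap.opNorm_comp_le _ _
    _ ≤ ‖fderiv ℝ u x‖ :=
        mul_le_of_le_one_left (norm_nonneg _)
          (norm_fderiv_le_of_lipschitz ℝ lipschitzWith_smoothExcess)

end LaplacianSmoothExcess

section Growth

variable {J : ℝ → ℝ} (hJ_nonneg : ∀ t < 0, 0 ≤ J t)
  (hJ_growth : 0 < liminf (fun t : ℝ => ((J t / √|t| : ℝ) : EReal)) atBot)
  (hJ_neg : ∀ t < 0, deriv J t < 0)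

include hJ_neg in
theorem strictAntiOn_Iio_of_deriv_neg : StrictAntiOn J (Iio 0) :=
  strictAntiOn_of_deriv_neg (convex_Iio 0)
    (fun t ht => (differentiableAt_of_deriv_ne_zero (hJ_neg t ht).ne).continuousAt
      |>.continuousWithinAt)
    (by simpa using hJ_neg)

include hJ_growth in
theorem exists_sqrt_one_sub_le_mul_atBot :
    ∃ C, 0 ≤ C ∧ ∀ᶠ t in atBot, √(1 - t) ≤ C * J t := by
  obtain ⟨K, hK, hlim⟩ := EReal.lt_iff_exists_real_btwn.1 hJ_growth
  have hK₀ : 0 < K := by exact_mod_cast hK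
  refine ⟨√2 / K, by positivity, ?_⟩
  filter_upwards [eventually_lt_of_lt_liminf hlim, eventually_le_atBot (-1)] with t ht ht₁
  have htJ : K * √|t| < J t := (lt_div_iff₀ (Real.sqrt_pos.2 (abs_pos.2 (by linarith)))).1
    (EReal.coe_lt_coe_iff.1 ht)
  calc √(1 - t) ≤ √(2 * |t|) := Real.sqrt_le_sqrt (by rw [abs_of_neg] <;> linarith)
    _ = √2 / K * (K * √|t|) := by
      rw [Real.sqrt_mul zero_le_two]
      field_simp
    _ ≤ √2 / K * J t := by gcongr

include hJ_nonneg hJ_growth hJ_neg in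
theorem exists_sqrt_one_sub_le_mul {δ : ℝ} (hδ : 0 < δ) :
    ∃ C, 0 ≤ C ∧ ∀ t ≤ -δ, √(1 - t) ≤ C * J t := by
  have hanti := strictAntiOn_Iio_of_deriv_neg hJ_neg
  have hJδ : 0 < J (-δ) := (hJ_nonneg (-(δ / 2)) (by linarith)).trans_lt
    (hanti (mem_Iio.2 (by linarith)) (mem_Iio.2 (by linarith)) (by linarith))
  obtain ⟨C, hC, hfar⟩ := exists_sqrt_one_sub_le_mul_atBot hJ_growth
  obtain ⟨T, hT⟩ := eventually_atBot.1 hfar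
  refine ⟨max C (√(1 - T) / J (-δ)), le_max_of_le_left hC, fun t ht => ?_⟩
  have hJt : J (-δ) ≤ J t :=
    hanti.antitoneOn (mem_Iio.2 (by linarith)) (mem_Iio.2 (by linarith)) ht
  rcases le_total t T with htT | htT
  · calc √(1 - t) ≤ C * J t := hT t htT
      _ ≤ max C (√(1 - T) / J (-δ)) * J t := by
        gcongr
        · exact hJδ.le.trans hJt
        · exact le_max_left _ _
  · calc √(1 - t) ≤ √(1 - T) / J (-δ) * J (-δ) := by
          rw [div_mul_cancel₀ _ hJδ.ne']
          gcongr
      _ ≤ max C (√(1 - T) / J (-δ)) * J t := by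
        gcongr
        exact le_max_right _ _

variable {E F : Type*} [MeasurableSpace E] {μ : Measure E} [TopologicalSpace E]
  [OpensMeasurableSpace E] [NormedAddCommGroup F] {u : E → F} {r : ℝ}

include hJ_nonneg hJ_growth hJ_neg in
theorem integrable_smoothExcess_comp (hu : Continuous u) (hr : 1 < r)
    (hpot : ∫⁻ x, ENNReal.ofReal (J (1 - ‖u x‖ ^ 2)) ∂μ < ⊤) :
    Integrable (smoothExcess r ∘ u) μ := by
  obtain ⟨C, hC, hCJ⟩ := exists_sqrt_one_sub_le_mul hJ_nonneg hJ_growth hJ_neg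
    (show 0 < r ^ 2 - 1 by nlinarith)
  have hbound : ∀ y : F, ENNReal.ofReal (smoothExcess r y) ≤
      ENNReal.ofReal C * ENNReal.ofReal (J (1 - ‖y‖ ^ 2)) := fun y => by
    rcases le_total ‖y‖ r with hy | hy
    · simp [smoothExcess_of_norm_le hy]
    · have hnorm : ‖y‖ ≤ C * J (1 - ‖y‖ ^ 2) := by
        have hsqrt : √(1 - (1 - ‖y‖ ^ 2)) = ‖y‖ := by
          rw [show 1 - (1 - ‖y‖ ^ 2) = ‖y‖ ^ 2 by ring, Real.sqrt_sq (norm_nonneg y)]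
        exact hsqrt.ge.trans (hCJ (1 - ‖y‖ ^ 2) (by nlinarith))
      rw [← ENNReal.ofReal_mul hC]
      exact ENNReal.ofReal_le_ofReal ((smoothExcess_le_norm (by linarith) hy).trans hnorm)
  refine (lintegral_ofReal_ne_top_iff_integrable
    (lipschitzWith_smoothExcess.continuous.comp hu).aestronglyMeasurable
    (ae_of_all _ fun x => smoothExcess_nonneg r (u x))).1 (ne_top_of_le_ne_top ?_
      (lintegral_mono fun x => hbound (u x)))
  rw [lintegral_const_mul' _ _ ENNReal.ofReal_ne_top]
  exact ENNReal.mul_ne_top ENNReal.ofReal_ne_top hpot.ne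

end Growth

section Energy

theorem opNorm_le_sqrt_sum_sq_norm_apply {ι E F : Type*} [Fintype ι] [NormedAddCommGroup E]
    [InnerProductSpace ℝ E] [NormedAddCommGroup F] [NormedSpace ℝ F] (b : OrthonormalBasis ι ℝ E)
    (A : E →L[ℝ] F) : ‖A‖ ≤ √(∑ i, ‖A (b i)‖ ^ 2) := by
  refine A.opNorm_le_bound (Real.sqrt_nonneg _) fun x => ?_
  calc ‖A x‖ = ‖∑ i, inner ℝ (b i) x • A (b i)‖ := by
        simp only [← map_smul, ← map_sum, b.sum_repr']
    _ ≤ ∑ i, ‖A (b i)‖ * ‖inner ℝ (b i) x‖ := norm_sum_le_of_le _ fun i _ => by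
        rw [norm_smul, mul_comm]
    _ ≤ √(∑ i, ‖A (b i)‖ ^ 2) * √(∑ i, ‖inner ℝ (b i) x‖ ^ 2) :=
        Real.sum_mul_le_sqrt_mul_sqrt _ _ _
    _ = √(∑ i, ‖A (b i)‖ ^ 2) * ‖x‖ := by
        rw [b.sum_sq_norm_inner_right, Real.sqrt_sq (norm_nonneg x)]

theorem sq_norm_fderiv_le_gradSq (u : Plane → Plane) (x : Plane) :
    ‖fderiv ℝ u x‖ ^ 2 ≤ gradSq u x := by
  refine (Real.le_sqrt (norm_nonneg _)
    (Finset.sum_nonneg fun i _ => sq_nonneg _)).1 ?_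
  simpa using opNorm_le_sqrt_sum_sq_norm_apply (EuclideanSpace.basisFun (Fin 2) ℝ) (fderiv ℝ u x)

theorem memLp_fderiv_of_lintegral_gradSq_lt_top {u : Plane → Plane} (hu : ContDiff ℝ 1 u)
    (hfin : ∫⁻ x, ENNReal.ofReal (gradSq u x) < ⊤) : MemLp (fderiv ℝ u) 2 := by
  have hcont : Continuous (gradSq u) := continuous_finsetSum _ fun i _ =>
    (continuous_fderiv_apply_of_contDiff_one hu _).norm.pow 2
  have hgrad : Integrable (gradSq u) :=
    (lintegral_ofReal_ne_top_iff_integrable hcont.aestronglyMeasurable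
      (ae_of_all _ fun x => Finset.sum_nonneg fun i _ => sq_nonneg _)).1 hfin.ne
  have hderiv : Continuous (fderiv ℝ u) := hu.continuous_fderiv one_ne_zero
  refine (memLp_two_iff_integrable_sq_norm hderiv.aestronglyMeasurable).2 <|
    hgrad.mono' (hderiv.norm.pow 2).aestronglyMeasurable (ae_of_all _ fun x => ?_)
  rw [Real.norm_of_nonneg (sq_nonneg _)]
  exact sq_norm_fderiv_le_gradSq u x

end Energy

theorem proposition2p1_general {E F : Type*} [NormedAddCommGroup E] [InnerProductSpace ℝ E]
    [FiniteDimensional ℝ E] [MeasurableSpace E] [BorelSpace E] (μ : Measure E)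
    [μ.IsAddHaarMeasure] [NormedAddCommGroup F] [InnerProductSpace ℝ F] {J : ℝ → ℝ}
    (hJ_nonneg : ∀ t < 0, 0 ≤ J t)
    (hJ_growth : 0 < liminf (fun t : ℝ => ((J t / √|t| : ℝ) : EReal)) atBot)
    (hJ_neg : ∀ t < 0, deriv J t < 0) {u : E → F} (hu : ContDiff ℝ 2 u)
    (hsol : ∀ x, -Δ u x = deriv J (1 - ‖u x‖ ^ 2) • u x)
    (hfin : finrank ℝ E ≤ 2 ∧ MemLp (fderiv ℝ u) 2 μ ∨
      ∫⁻ x, ENNReal.ofReal (J (1 - ‖u x‖ ^ 2)) ∂μ < ⊤) (x : E) :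
    ‖u x‖ ≤ 1 := by
  have hinner : ∀ x, 1 < ‖u x‖ → 0 < inner ℝ (u x) (Δ u x) := fun x hx => by
    rw [← neg_neg (Δ u x), hsol, ← neg_smul, inner_smul_right, real_inner_self_eq_norm_sq]
    exact mul_pos (neg_pos.2 (hJ_neg _ (by nlinarith))) (by positivity)
  rcases hfin with ⟨hdim, henergy⟩ | hpot
  · exact norm_le_of_memLp_fderiv hu zero_le_one hinner μ hdim henergy x
  · exact norm_le_of_integrable_smoothExcess_comp hu zero_le_one hinner μ (fun r hr =>
      integrable_smoothExcess_comp hJ_nonneg hJ_growth hJ_neg hu.continuous hr hpot) x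

theorem proposition2p1
    (J : ℝ → ℝ) (hJ : ContDiff ℝ 2 J) (hJ_nonneg : ∀ t : ℝ, 0 ≤ J t)
    (hJ_zero : J 0 = 0) (hJ_pos : ∀ t : ℝ, 0 < t → 0 < J t)
    (hJ_growth : ∃ K : ℝ, 0 < K ∧
      (K : EReal) < Filter.liminf (fun t : ℝ => ((J t / √|t| : ℝ) : EReal)) Filter.atBot)
    (hJ_neg : ∀ t : ℝ, t < 0 → deriv J t < 0)
    (u : Plane → Plane) (hu : IsClassicalSolution J u)
    (hfin : (∫⁻ x : Plane, ENNReal.ofReal (gradSq u x)) < ⊤ ∨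
      (∫⁻ x : Plane, ENNReal.ofReal (J (1 - ‖u x‖ ^ 2))) < ⊤) :
    ∀ x : Plane, ‖u x‖ ≤ 1 := by
  obtain ⟨K, hK, hlim⟩ := hJ_growth
  exact proposition2p1_general volume (fun t _ => hJ_nonneg t)
    ((EReal.coe_pos.2 hK).trans hlim) hJ_neg hu.1 hu.2 <| hfin.imp_left fun henergy =>
      ⟨by simp, memLp_fderiv_of_lintegral_gradSq_lt_top (hu.1.of_le one_le_two) henergy⟩
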